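/- Let $n\ge 6$. For complex parameters $\alpha=(\alpha_3,\dots,\alpha_n,\theta)\in\mathbb C^{n-1}$ let $L(\alpha)$ be the $(n+1)$-dimensional complex algebra with basis $e_0,\dots,e_n$ and products $$[e_0,e_0]=e_2,\qquad [e_i,e_0]=e_{i+1}\ (1\le i\le n-1),\qquad [e_0,e_1]=\alpha_3e_3+\dots+\alpha_{n-1}e_{n-1}+\theta e_n,$$ $$[e_j,e_1]=\alpha_3e_{j+2}+\alpha_4e_{j+3}+\dots+\alpha_{n+1-j}e_n\ (1\le j\le n-2),$$ all other products of basis vectors being zero. For $3\le k<t\le n$ put $$c_{k,t}(y;\alpha)=\sum_{j=1}^{k-1}\binom{k-1}{k-1-j}y^{j}\sum_{i_{j-1}=k+j}^{t}\ \sum_{i_{j-2}=k+j}^{i_{j-1}}\cdots\sum_{i_1=k+j}^{i_2}\alpha_{t+3-i_{j-1}}\,\alpha_{i_{j-1}+3-i_{j-2}}\cdots\alpha_{i_2+3-i_1}\,\alpha_{i_1+3-k-j}$$ (for $j=1$ the inner expression is $\alpha_{t+2-k}$, for $j=2$ it is $\sum_{i_1=k+2}^{t}\alpha_{t+3-i_1}\alpha_{i_1+1-k}$),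 and define recursively $$\varphi_t(y;\alpha)=(1+y)\alpha_t-\sum_{k=3}^{t-1}c_{k,t}(y;\alpha)\,\varphi_k(y;\alpha)\quad(3\le t\le n),$$ $$\varphi_{n+1}(y;\alpha)=\theta+y\alpha_n-\sum_{k=3}^{n-1}c_{k,n}(y;\alpha)\,\varphi_k(y;\alpha).$$ Put $\rho_i(x,y;\alpha)=x^i\varphi_{i+2}(y;\alpha)$ for $1\le i\le n-2$ and $\rho_{n-1}(x,y;\alpha)=x^{n-2}\varphi_{n+1}(y;\alpha)$. Let $U''_1$ be the set of algebras $L(\alpha)$ with $\alpha_3\ne0$, $\alpha_4+2\alpha_3^2=0$ and $(\alpha_5-5\alpha_3^3)(\alpha_6+6\alpha_3\alpha_5-16\alpha_3^4)\ne0$, and for $L(\alpha)\in U''_1$ and $4\le i\le n-1$ put $$R_i(\alpha)=\rho_i\!\left(\frac{5\alpha_3^3-\alpha_5}{\alpha_6+6\alpha_3\alpha_5-16\alpha_3^4},\ \frac{\alpha_6+7\alpha_3\alpha_5-21\alpha_3^4}{\alpha_3(5\alpha_3^3-\alpha_5)};\ \alpha\right).$$ Then: 1. two algebras $L(\alpha)$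 and $L(\alpha')$ from $U''_1$ are isomorphic if and only if $R_i(\alpha)=R_i(\alpha')$ for all $i=4,\dots,n-1$; 2. $R_4(\alpha)\ne-14$ for every $L(\alpha)\in U''_1$; 3. for every $(a_4,\dots,a_{n-1})\in\mathbb C^{n-4}$ with $a_4\ne-14$ there is an algebra $L(\alpha)\in U''_1$ such that $R_i(\alpha)=a_i$ for all $i=4,\dots,n-1$. -/

import Mathlib

namespace Filiform

/-- The basis vector `e_k` of `ℂ^(n+1)`, with coordinates indexed by `0, …, n`
(and `0` when `k > n`). -/
def e (n k : ℕ) : Fin (n + 1) → ℂ := fun i => if (i : ℕ) = k then 1 else 0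

/-- The multiplication table of `L(α)`, `α = (α_3, …, α_n, θ)`: the value `[e_i, e_j]`.
Only the values `α 3, …, α n` of the function `α` are used.
* `[e_0, e_0] = e_2`, and `[e_i, e_0] = e_{i+1}` for `1 ≤ i ≤ n - 1`;
* `[e_0, e_1] = α_3 e_3 + ⋯ + α_{n-1} e_{n-1} + θ e_n`;
* `[e_j, e_1] = α_3 e_{j+2} + α_4 e_{j+3} + ⋯ + α_{n+1-j} e_n` for `1 ≤ j ≤ n - 2`;
* all other products of basis vectors are zero. -/
noncomputable def table (n : ℕ) (α : ℕ → ℂ) (θ : ℂ) (i j : ℕ) : Fin (n + 1) → ℂ :=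
  if j = 0 then
    if i = 0 then e n 2
    else if i ≤ n - 1 then e n (i + 1)
    else 0
  else if j = 1 then
    if i = 0 then (∑ m ∈ Finset.Icc 3 (n - 1), α m • e n m) + θ • e n n
    else if i ≤ n - 2 then ∑ m ∈ Finset.Icc 3 (n + 1 - i), α m • e n (i + m - 1)
    else 0
  else 0

/-- The multiplication of the `(n+1)`-dimensional algebra `L(α)`, the bilinear extension of
the multiplication table. -/
noncomputable def bracket (n : ℕ) (α : ℕ → ℂ) (θ : ℂ) :
    (Fin (n + 1) → ℂ) →ₗ[ℂ] (Fin (n + 1) → ℂ) →ₗ[ℂ] (Fin (n + 1) → ℂ) :=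
  (Pi.basisFun ℂ (Fin (n + 1))).constr ℂ fun i =>
    (Pi.basisFun ℂ (Fin (n + 1))).constr ℂ fun j => table n α θ i j

/-- `L(α)` and `L(α')` are isomorphic: some linear bijection carries one multiplication to
the other. -/
def Isomorphic (n : ℕ) (α : ℕ → ℂ) (θ : ℂ) (α' : ℕ → ℂ) (θ' : ℂ) : Prop :=
  ∃ g : (Fin (n + 1) → ℂ) ≃ₗ[ℂ] (Fin (n + 1) → ℂ),
    ∀ u v, g (bracket n α θ u v) = bracket n α' θ' (g u) (g v)

/-- The iterated sum
`∑_{i_r = a}^{t} ∑_{i_{r-1} = a}^{i_r} ⋯ ∑_{i_1 = a}^{i_2}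
  z_{t+3-i_r} z_{i_r+3-i_{r-1}} ⋯ z_{i_2+3-i_1} z_{i_1+3-a}`,
which for `r = 0` is `z_{t+3-a}`. -/
noncomputable def nest (z : ℕ → ℂ) (a : ℕ) : ℕ → ℕ → ℂ
  | 0, t => z (t + 3 - a)
  | r + 1, t => ∑ i ∈ Finset.Icc a t, z (t + 3 - i) * nest z a r i

/-- The coefficient of `φ_k` in the recursions for `φ_t` and `φ_{n+1}`:
`∑_{j=1}^{k-1} C(k-1, k-1-j) y^j ∑_{i_{j-1} = k+j}^{t} ⋯ ∑_{i_1 = k+j}^{i_2}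
  z_{t+3-i_{j-1}} ⋯ z_{i_2+3-i_1} z_{i_1+3-k-j}`. -/
noncomputable def coef (z : ℕ → ℂ) (y : ℂ) (k t : ℕ) : ℂ :=
  ∑ j ∈ Finset.Icc 1 (k - 1),
    ((k - 1).choose (k - 1 - j) : ℂ) * y ^ j * nest z (k + j) (j - 1) t

/-- `φ_t(y; z) = (1 + y) z_t - ∑_{k=3}^{t-1} coef_k · φ_k(y; z)`, for `3 ≤ t ≤ n`. -/
noncomputable def phi (z : ℕ → ℂ) (y : ℂ) (t : ℕ) : ℂ :=
  (1 + y) * z t - ∑ k ∈ (Finset.Icc 3 (t - 1)).attach, coef z y k.1 t * phi z y k.1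
termination_by t
decreasing_by
  have h := Finset.mem_Icc.1 k.2
  omega

/-- The recursion for `φ_t`, without the bookkeeping that its termination needs. -/
theorem phi_eq (z : ℕ → ℂ) (y : ℂ) (t : ℕ) :
    phi z y t = (1 + y) * z t - ∑ k ∈ Finset.Icc 3 (t - 1), coef z y k t * phi z y k := by
  rw [phi, Finset.sum_attach (Finset.Icc 3 (t - 1)) fun k => coef z y k t * phi z y k]

/-- `φ_{n+1}(y; z_3, …, z_n, θ) = θ + y z_n - ∑_{k=3}^{n-1} coef_k · φ_k(y; z)`, where
`coef_k` is the coefficient of `φ_k` in the recursion for `φ_n`. -/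
noncomputable def phiLast (n : ℕ) (z : ℕ → ℂ) (θ y : ℂ) : ℂ :=
  θ + y * z n - ∑ k ∈ Finset.Icc 3 (n - 1), coef z y k n * phi z y k

/-- `ρ_i(x, y; α)` for `1 ≤ i ≤ n - 1`: it is `x^i φ_{i+2}(y; α)` for `1 ≤ i ≤ n - 2`, and
`x^(n-2) φ_{n+1}(y; α)` for `i = n - 1`. -/
noncomputable def rho (n i : ℕ) (x y : ℂ) (α : ℕ → ℂ) (θ : ℂ) : ℂ :=
  if i = n - 1 then x ^ (n - 2) * phiLast n α θ y else x ^ i * phi α y (i + 2)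

/-- The stratum `U''_1`. -/
def InStratum (α : ℕ → ℂ) : Prop :=
  α 3 ≠ 0 ∧ α 4 + 2 * α 3 ^ 2 = 0 ∧
    (α 5 - 5 * α 3 ^ 3) * (α 6 + 6 * α 3 * α 5 - 16 * α 3 ^ 4) ≠ 0

/-- `ρ_i` at the normalizing parameters
`x = (5α_3³ - α_5) / (α_6 + 6α_3α_5 - 16α_3⁴)` and
`y = (α_6 + 7α_3α_5 - 21α_3⁴) / (α_3 (5α_3³ - α_5))`. -/
noncomputable def rhoNorm (n i : ℕ) (α : ℕ → ℂ) (θ : ℂ) : ℂ :=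
  rho n i
    ((5 * α 3 ^ 3 - α 5) / (α 6 + 6 * α 3 * α 5 - 16 * α 3 ^ 4))
    ((α 6 + 7 * α 3 * α 5 - 21 * α 3 ^ 4) / (α 3 * (5 * α 3 ^ 3 - α 5)))
    α θ

end Filiform

/-! Identify the span of `e_1, …, e_n` with `ℂ[X]/X^n`, where `e_{k+1}` is `X^k`, and let `f` be
`symbol n α`. Right multiplication by `v` acts there as multiplication by `v_0 X + v_1 f`, while
`e_0 - e_1` is almost a left annihilator: it only sees `(θ - α_n) e_n`. An isomorphism from `L(α)`
to `L(α')` with `e_0 ↦ A e_0 + B e_1 + ⋯` therefore replaces `X` by `s = A X + B f'`, and it exists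
exactly when `f(s) ≡ (A + B) f'` modulo `X^n` and `θ' - α'_n = A^(n-2) (θ - α_n)`, with `A` and `A +
B` nonzero (`isomorphic_of_dvd`, `Isomorphic.exists_dvd`).

Comparing coefficients with `x = 1/A`, `y = B/A` turns the congruence into the recursion for `φ`
(`X_pow_dvd_comp_symbol_sub_iff`, `isTransform_iff`).

On the stratum, `α_3`, `D_5 = α_5 - 5α_3³` and `D_6 = α_6 + 6α_3α_5 - 16α_3⁴` are multiplied by
`x(1+y)`, `x³(1+y)` and `x⁴(1+y)`. So exactly one pair `(x, y)` achieves `α_3 = 1` and `D_6 = -D_5`,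
and each isomorphism class contains one such normal form. There `α_4 = -2`, `α_6 = 21 - 7α_5` and
`α_5 ≠ 5`, that is, `α_6 ≠ -14`. The `R_i` are the remaining coefficients of this normal form. -/

namespace Filiform

open Polynomial

/-! ### The recursion for `φ` as a congruence of polynomials -/

/-- The polynomial `α_3 X² + α_4 X³ + ⋯ + α_n X^(n-1)`, through which right multiplication by
`e_1` acts. -/
noncomputable def symbol (n : ℕ) (α : ℕ → ℂ) : ℂ[X] :=
  ∑ k ∈ Finset.Icc 3 n, C (α k) * X ^ (k - 1)

/-- The quotient of `symbol n α` by `X`. -/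
noncomputable def symbolDivX (n : ℕ) (α : ℕ → ℂ) : ℂ[X] :=
  ∑ k ∈ Finset.Icc 3 n, C (α k) * X ^ (k - 2)

theorem symbol_eq_X_mul (n : ℕ) (α : ℕ → ℂ) : symbol n α = X * symbolDivX n α := by
  rw [symbol, symbolDivX, Finset.mul_sum]
  refine Finset.sum_congr rfl fun k hk => ?_
  have h : k - 1 = (k - 2) + 1 := by have := (Finset.mem_Icc.1 hk).1; omega
  rw [h, pow_succ]; ring

theorem coeff_symbolDivX (n : ℕ) (α : ℕ → ℂ) (d : ℕ) :
    (symbolDivX n α).coeff d = if 1 ≤ d ∧ d + 2 ≤ n then α (d + 2) else 0 := by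
  simp only [symbolDivX, finsetSum_coeff, coeff_C_mul, coeff_X_pow, mul_ite, mul_one, mul_zero]
  split_ifs with h
  · rw [Finset.sum_eq_single (d + 2)]
    · simp
    · intro k hk hne
      have := (Finset.mem_Icc.1 hk).1
      rw [if_neg (by omega)]
    · intro hk
      exact absurd (Finset.mem_Icc.2 (by omega)) hk
  · refine Finset.sum_eq_zero fun k hk => ?_
    have := Finset.mem_Icc.1 hk
    rw [if_neg (by omega)]

theorem coeff_symbol (n : ℕ) (α : ℕ → ℂ) (d : ℕ) :
    (symbol n α).coeff d = if 2 ≤ d ∧ d + 1 ≤ n then α (d + 1) else 0 := by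
  rw [symbol_eq_X_mul]
  rcases d with _ | d
  · simp
  · rw [coeff_X_mul, coeff_symbolDivX]
    exact if_congr (by omega) rfl rfl

theorem X_dvd_symbolDivX (n : ℕ) (α : ℕ → ℂ) : X ∣ symbolDivX n α := by
  rw [X_dvd_iff, coeff_symbolDivX]; simp

theorem X_sq_dvd_symbol (n : ℕ) (α : ℕ → ℂ) : X ^ 2 ∣ symbol n α := by
  rw [symbol_eq_X_mul, pow_two]
  exact mul_dvd_mul_left _ (X_dvd_symbolDivX n α)

theorem comp_symbol (n : ℕ) (α : ℕ → ℂ) (p : ℂ[X]) :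
    (symbol n α).comp p = ∑ k ∈ Finset.Icc 3 n, C (α k) * p ^ (k - 1) := by
  rw [symbol, comp, eval₂_finsetSum]
  simp

/-- The iterated sum is a convolution: a factor `z_{i'+3-i}` is the coefficient of `X^(i'-i+1)`. The
extra terms of the full convolution vanish because `symbolDivX` has no constant term, and `htn`
keeps all indices at most `n`. -/
theorem nest_eq_coeff {n : ℕ} (z : ℕ → ℂ) {a : ℕ} (r : ℕ) {t : ℕ} (hat : a ≤ t)
    (htn : t + 3 ≤ n + a) :
    nest z a r t = (symbolDivX n z ^ (r + 1)).coeff (t - a + (r + 1)) := by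
  induction r generalizing t with
  | zero =>
    rw [nest, zero_add, pow_one, coeff_symbolDivX, if_pos (by omega)]
    congr 1; omega
  | succ r ih =>
    obtain ⟨m, rfl⟩ := Nat.exists_eq_add_of_le hat
    rw [nest, pow_succ (symbolDivX n z) (r + 1), coeff_mul,
      Finset.Nat.sum_antidiagonal_eq_sum_range_succ_mk]
    have hX : X ^ (r + 1) ∣ symbolDivX n z ^ (r + 1) :=
      pow_dvd_pow_of_dvd (X_dvd_symbolDivX n z) _
    rw [X_pow_dvd_iff] at hX
    rw [show (Finset.Icc a (a + m)) = (Finset.Ico a (a + m + 1)) by ext; simp,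
      Finset.sum_Ico_eq_sum_range]
    rw [show (a + m - a + (r + 1 + 1)).succ = (r + 1) + ((m + 1) + 1) by omega,
      Finset.sum_range_add, Finset.sum_eq_zero (s := Finset.range (r + 1)), zero_add,
      Finset.sum_range_succ]
    · rw [coeff_symbolDivX (d := _ - (r + 1 + (m + 1))), if_neg (by omega), mul_zero, add_zero,
        show a + m + 1 - a = m + 1 by omega]
      refine Finset.sum_congr rfl fun i hi => ?_
      have hi := Finset.mem_range.1 hi
      rw [ih (by omega) (by omega), coeff_symbolDivX, if_pos (by omega), mul_comm]
      congr 2 <;> omega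
    · intro i hi
      rw [hX i (Finset.mem_range.1 hi), zero_mul]

/-- Factor `X` out of the base and expand the remaining power by the binomial theorem; the index `j`
counts the factors `y * symbolDivX`. -/
theorem coef_eq_coeff {n : ℕ} (z : ℕ → ℂ) (y : ℂ) {k t : ℕ} (hk : 3 ≤ k) (hkt : k < t)
    (htn : t ≤ n) :
    coef z y k t = ((X + C y * symbol n z) ^ (k - 1)).coeff (t - 1) := by
  have h1 : X + C y * symbol n z = (C y * symbolDivX n z + 1) * X := by
    rw [symbol_eq_X_mul]; ring
  have h2 : t - 1 = (t - k) + (k - 1) := by omega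
  rw [h1, mul_pow, h2, coeff_mul_X_pow, add_pow, finsetSum_coeff, Finset.sum_range_succ',
    coef]
  have h3 : (Finset.Icc 1 (k - 1)) = Finset.Ico 1 (k - 1 + 1) := by ext; simp
  rw [h3, Finset.sum_Ico_eq_sum_range]
  simp only [one_pow, mul_one, pow_zero, Nat.choose_zero_right, Nat.cast_one, mul_pow]
  -- The term with no factor `symbolDivX` is constant, hence invisible in degree `t - k > 0`.
  rw [coeff_one, if_neg (by omega), add_zero, Nat.add_sub_cancel]
  refine Finset.sum_congr rfl fun j hj => ?_
  have hj := Finset.mem_range.1 hj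
  rw [add_comm 1 j, ← C_pow, ← C_eq_natCast, coeff_mul_C, coeff_C_mul,
    Nat.choose_symm (by omega), Nat.add_sub_cancel]
  by_cases hat : k + (j + 1) ≤ t
  · rw [nest_eq_coeff (n := n) z j hat (by omega)]
    rw [show t - (k + (j + 1)) + (j + 1) = t - k by omega]
    ring
  · have hX : X ^ (j + 1) ∣ symbolDivX n z ^ (j + 1) :=
      pow_dvd_pow_of_dvd (X_dvd_symbolDivX n z) _
    rw [X_pow_dvd_iff] at hX
    rw [hX _ (by omega)]
    -- A single factor would give `k + 1 ≤ t`; with more factors the outer sum is empty.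
    rcases j with _ | j
    · omega
    · rw [nest, Finset.Icc_eq_empty (by omega)]; simp

theorem coeff_comp_symbol {n : ℕ} (β z : ℕ → ℂ) (y : ℂ) {t : ℕ} (ht : 3 ≤ t) (htn : t ≤ n) :
    ((symbol n β).comp (X + C y * symbol n z)).coeff (t - 1) =
      β t + ∑ k ∈ Finset.Icc 3 (t - 1), coef z y k t * β k := by
  have h1 : X + C y * symbol n z = (C y * symbolDivX n z + 1) * X := by
    rw [symbol_eq_X_mul]; ring
  have hsub : Finset.Icc 3 t ⊆ Finset.Icc 3 n := Finset.Icc_subset_Icc_right htn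
  rw [comp_symbol, finsetSum_coeff, ← Finset.sum_subset hsub]
  · have h4 : Finset.Icc 3 t = insert t (Finset.Icc 3 (t - 1)) := by
      ext; simp; omega
    rw [h4, Finset.sum_insert (by simp; omega)]
    congr 1
    · rw [coeff_C_mul, h1, mul_pow]
      rw [coeff_mul_X_pow', if_pos le_rfl, Nat.sub_self, coeff_zero_eq_eval_zero]
      simp [← coeff_zero_eq_eval_zero, coeff_symbolDivX]
    · refine Finset.sum_congr rfl fun k hk => ?_
      have hk := Finset.mem_Icc.1 hk
      rw [coeff_C_mul, coef_eq_coeff z y hk.1 (by omega) htn, mul_comm]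
  · intro k hk hk'
    have hk := Finset.mem_Icc.1 hk
    have hk' : t < k := by
      by_contra h
      exact hk' (Finset.mem_Icc.2 ⟨hk.1, by omega⟩)
    rw [coeff_C_mul, h1, mul_pow, coeff_mul_X_pow', if_neg (by omega), mul_zero]

/-- The coefficient equations are unitriangular in `β`, so they have a unique solution, and their
recursive form is the one defining `phi`. Degrees 0 and 1 carry no condition. -/
theorem X_pow_dvd_comp_symbol_sub_iff (n : ℕ) (β z : ℕ → ℂ) (y : ℂ) :
    X ^ n ∣ (symbol n β).comp (X + C y * symbol n z) - C (1 + y) * symbol n z ↔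
      ∀ t, 3 ≤ t → t ≤ n → β t = phi z y t := by
  have key : X ^ n ∣ (symbol n β).comp (X + C y * symbol n z) - C (1 + y) * symbol n z ↔
      ∀ t, 3 ≤ t → t ≤ n →
        β t + ∑ k ∈ Finset.Icc 3 (t - 1), coef z y k t * β k = (1 + y) * z t := by
    rw [X_pow_dvd_iff]
    constructor
    · intro h t ht htn
      have := h (t - 1) (by omega)
      rw [coeff_sub, coeff_comp_symbol β z y ht htn, coeff_C_mul, coeff_symbol,
        if_pos (by omega), sub_eq_zero] at this
      rw [this]; congr 2; omega
    · intro h d hd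
      by_cases h2 : 2 ≤ d
      · have := h (d + 1) (by omega) (by omega)
        rw [← coeff_comp_symbol (n := n) β z y (by omega) (by omega), Nat.add_sub_cancel] at this
        rw [coeff_sub, this, coeff_C_mul, coeff_symbol, if_pos (by omega), sub_self]
      · have h3 : X ^ 2 ∣ (symbol n β).comp (X + C y * symbol n z) := by
          obtain ⟨q, hq⟩ := X_sq_dvd_symbol n β
          rw [hq, mul_comp, X_pow_comp, symbol_eq_X_mul n z]
          refine Dvd.dvd.mul_right (pow_dvd_pow_of_dvd ?_ _) _
          exact ⟨1 + C y * symbolDivX n z, by ring⟩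
        have h4 := dvd_sub h3 ((X_sq_dvd_symbol n z).mul_left (C (1 + y)))
        exact X_pow_dvd_iff.1 h4 d (by omega)
  rw [key]
  constructor
  · intro h t
    induction t using Nat.strong_induction_on with
    | _ t ih =>
      intro ht htn
      rw [phi_eq, ← h t ht htn, eq_sub_iff_add_eq]
      congr 1
      refine Finset.sum_congr rfl fun k hk => ?_
      have hk := Finset.mem_Icc.1 hk
      rw [ih k (by omega) hk.1 (by omega)]
  · intro h t ht htn
    rw [h t ht htn, phi_eq, sub_add_eq_add_sub, sub_eq_iff_eq_add]
    congr 1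
    refine Finset.sum_congr rfl fun k hk => ?_
    have hk := Finset.mem_Icc.1 hk
    rw [h k hk.1 (by omega)]

theorem phiLast_eq {n : ℕ} (z : ℕ → ℂ) (θ y : ℂ) :
    phiLast n z θ y = phi z y n + (θ - z n) := by
  rw [phiLast, phi_eq]; ring

/-! ### Transformations of the parameters -/

/-- The algebra `L(β, η)` is obtained from `L(z, θ)` by the substitution with parameters `x, y`. -/
def IsTransform (n : ℕ) (x y : ℂ) (z : ℕ → ℂ) (θ : ℂ) (β : ℕ → ℂ) (η : ℂ) : Prop :=
  (∀ t, 3 ≤ t → t ≤ n → β t = x ^ (t - 2) * phi z y t) ∧ η = x ^ (n - 2) * phiLast n z θ y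

/-- Scaling `X` by `A` absorbs the powers of `x`. The condition on `θ` becomes linear because
`φ_{n+1}` and `φ_n` share the same correction sum. -/
theorem isTransform_iff {n : ℕ} (hn : 3 ≤ n) {A : ℂ} (hA : A ≠ 0) (B : ℂ) (z : ℕ → ℂ) (θ : ℂ)
    (β : ℕ → ℂ) (η : ℂ) :
    IsTransform n A⁻¹ (B / A) z θ β η ↔
      X ^ n ∣ (symbol n β).comp (C A * X + C B * symbol n z) - C (A + B) * symbol n z ∧
        θ - z n = A ^ (n - 2) * (η - β n) := by
  have h1 : (symbol n β).comp (C A * X + C B * symbol n z) - C (A + B) * symbol n z =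
      C A * ((symbol n fun k => A ^ (k - 2) * β k).comp (X + C (B / A) * symbol n z) -
        C (1 + B / A) * symbol n z) := by
    have h2 : C A * X + C B * symbol n z = C A * (X + C (B / A) * symbol n z) := by
      rw [mul_add, ← mul_assoc, ← C_mul, mul_div_cancel₀ _ hA]
    have h3 : A + B = A * (1 + B / A) := by field_simp
    rw [h2, h3, comp_symbol, comp_symbol, mul_sub, Finset.mul_sum, C_mul (a := A), mul_assoc (C A)]
    congr 1
    refine Finset.sum_congr rfl fun k hk => ?_
    have hk := Finset.mem_Icc.1 hk
    rw [mul_pow, show k - 1 = (k - 2) + 1 by omega, pow_succ (C A), C_mul, C_pow]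
    ring
  have hu : IsUnit (C A : ℂ[X]) := isUnit_C.2 (isUnit_iff_ne_zero.2 hA)
  rw [h1, hu.dvd_mul_left, X_pow_dvd_comp_symbol_sub_iff, IsTransform]
  have h5 : ∀ t, β t = A⁻¹ ^ (t - 2) * phi z (B / A) t ↔ A ^ (t - 2) * β t = phi z (B / A) t := by
    intro t
    rw [inv_pow, eq_inv_mul_iff_mul_eq₀ (pow_ne_zero _ hA)]
  simp only [h5]
  refine and_congr_right fun h => ?_
  rw [phiLast_eq, ← h n hn le_rfl, inv_pow, eq_inv_mul_iff_mul_eq₀ (pow_ne_zero _ hA)]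
  constructor <;> intro h6 <;> linear_combination -h6

/-! ### The algebra as truncated polynomials together with `e_0 - e_1` -/

/-- The linear map onto the span of `e_1, …, e_n` that sends `X^k` to `e_{k+1}`. -/
noncomputable def toVec (n : ℕ) : ℂ[X] →ₗ[ℂ] (Fin (n + 1) → ℂ) :=
  LinearMap.pi (Fin.cons 0 fun i : Fin n => lcoeff ℂ i)

/-- The vector `e_0 - e_1`. -/
noncomputable def diffVec (n : ℕ) : Fin (n + 1) → ℂ := e n 0 - e n 1

/-- The polynomial that represents `u - u_0 (e_0 - e_1)`. -/
noncomputable def tail (n : ℕ) : (Fin (n + 1) → ℂ) →ₗ[ℂ] ℂ[X] :=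
  (∑ i : Fin n, monomial (i : ℕ) ∘ₗ LinearMap.proj i.succ) + monomial 0 ∘ₗ LinearMap.proj 0

variable {n : ℕ}

@[simp] theorem toVec_zero_coord (p : ℂ[X]) : toVec n p 0 = 0 := by simp [toVec]

@[simp] theorem toVec_succ_coord (p : ℂ[X]) (i : Fin n) : toVec n p i.succ = p.coeff i := by
  simp [toVec]

theorem val_one_of_pos (hn : 1 ≤ n) : ((1 : Fin (n + 1)) : ℕ) = 1 := by
  rw [Fin.val_one']; exact Nat.mod_eq_of_lt (by omega)

theorem one_eq_succ (hn : 1 ≤ n) : (1 : Fin (n + 1)) = Fin.succ ⟨0, hn⟩ := by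
  exact Fin.ext (val_one_of_pos hn)

theorem toVec_one_coord (hn : 1 ≤ n) (p : ℂ[X]) : toVec n p 1 = p.coeff 0 := by
  rw [one_eq_succ hn, toVec_succ_coord]

theorem toVec_X_pow (k : ℕ) : toVec n (X ^ k) = e n (k + 1) := by
  ext i
  refine Fin.cases ?_ (fun i => ?_) i
  · simp [e]
  · simp [e, coeff_X_pow]

theorem toVec_eq_zero_iff (p : ℂ[X]) : toVec n p = 0 ↔ X ^ n ∣ p := by
  rw [X_pow_dvd_iff]
  constructor
  · intro h d hd
    rw [← toVec_succ_coord p ⟨d, hd⟩, h]; rfl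
  · intro h
    ext i
    refine Fin.cases ?_ (fun i => ?_) i
    · simp
    · simp [h i i.2]

theorem toVec_eq_iff (p q : ℂ[X]) : toVec n p = toVec n q ↔ X ^ n ∣ p - q := by
  rw [← toVec_eq_zero_iff, map_sub, sub_eq_zero]

theorem toVec_C_mul (c : ℂ) (p : ℂ[X]) : toVec n (C c * p) = c • toVec n p := by
  rw [← smul_eq_C_mul, map_smul]

theorem e_eq_zero {k : ℕ} (hk : n < k) : e n k = 0 := by
  ext i
  simp [e, show (i : ℕ) ≠ k by omega]

@[simp] theorem diffVec_zero_coord : diffVec n 0 = 1 := by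
  simp [diffVec, e]

theorem diffVec_one_coord (hn : 1 ≤ n) : diffVec n 1 = -1 := by
  rw [diffVec, Pi.sub_apply, e, e, val_one_of_pos hn]
  simp

theorem toVec_tail (u : Fin (n + 1) → ℂ) :
    toVec n (tail n u) = u - u 0 • diffVec n := by
  ext i
  refine Fin.cases ?_ (fun i => ?_) i
  · simp
  · simp only [toVec_succ_coord, tail, LinearMap.add_apply, LinearMap.sum_apply,
      LinearMap.comp_apply, LinearMap.proj_apply, coeff_add, finsetSum_coeff, coeff_monomial]
    rw [Finset.sum_eq_single i (fun j _ hj => if_neg fun h => hj (Fin.ext h)) (by simp)]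
    simp [diffVec, e, eq_comm]

theorem eq_add_toVec_tail (u : Fin (n + 1) → ℂ) :
    u = u 0 • diffVec n + toVec n (tail n u) := by
  rw [toVec_tail]; abel

theorem tail_toVec (p : ℂ[X]) : X ^ n ∣ tail n (toVec n p) - p := by
  rw [← toVec_eq_iff, toVec_tail]; simp

theorem bracket_apply (hn : 1 ≤ n) (α : ℕ → ℂ) (θ : ℂ) (u v : Fin (n + 1) → ℂ) :
    bracket n α θ u v =
      ∑ i : Fin (n + 1), u i • (v 0 • table n α θ i 0 + v 1 • table n α θ i 1) := by
  rw [bracket, Module.Basis.constr_apply_fintype, LinearMap.sum_apply]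
  refine Finset.sum_congr rfl fun i _ => ?_
  rw [LinearMap.smul_apply, Module.Basis.constr_apply_fintype, Fintype.sum_eq_add 0 1]
  · rw [val_one_of_pos hn]; simp
  · intro h
    have := congrArg Fin.val h
    rw [val_one_of_pos hn] at this
    exact zero_ne_one this
  · rintro j ⟨h0, h1⟩
    have h0 : (j : ℕ) ≠ 0 := fun h => h0 (Fin.ext h)
    have h1 : (j : ℕ) ≠ 1 := fun h => h1 (Fin.ext (h.trans (val_one_of_pos hn).symm))
    simp [table, h0, h1]

theorem bracket_e (hn : 1 ≤ n) (α : ℕ → ℂ) (θ : ℂ) {k : ℕ} (hk : k ≤ n)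
    (v : Fin (n + 1) → ℂ) :
    bracket n α θ (e n k) v = v 0 • table n α θ k 0 + v 1 • table n α θ k 1 := by
  rw [bracket_apply hn, Finset.sum_eq_single ⟨k, by omega⟩]
  · simp [e]
  · intro j _ hj
    rw [e, if_neg fun h => hj (Fin.ext h), zero_smul]
  · simp

theorem table_succ_zero (α : ℕ → ℂ) (θ : ℂ) (k : ℕ) :
    table n α θ (k + 1) 0 = toVec n (X * X ^ k) := by
  rw [← pow_succ', toVec_X_pow, table]
  simp only [if_true]
  rw [if_neg (by omega)]
  split_ifs with h
  · rfl
  · rw [e_eq_zero (by omega)]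

theorem table_succ_one (α : ℕ → ℂ) (θ : ℂ) (k : ℕ) :
    table n α θ (k + 1) 1 = toVec n (symbol n α * X ^ k) := by
  have h1 : toVec n (symbol n α * X ^ k) = ∑ m ∈ Finset.Icc 3 n, α m • e n (k + m) := by
    rw [symbol, Finset.sum_mul, map_sum]
    refine Finset.sum_congr rfl fun m hm => ?_
    have hm := Finset.mem_Icc.1 hm
    rw [mul_assoc, toVec_C_mul, ← pow_add, toVec_X_pow, show m - 1 + k + 1 = k + m by omega]
  have h2 : ∀ m, k + 1 + m - 1 = k + m := fun m => by omega
  rw [h1, table]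
  simp only [one_ne_zero, if_false, if_true, h2]
  rw [if_neg (by omega)]
  split_ifs with h
  · refine Finset.sum_subset (Finset.Icc_subset_Icc_right (by omega)) fun m hm hm' => ?_
    rw [Finset.mem_Icc] at hm hm'
    rw [e_eq_zero (by omega), smul_zero]
  · refine (Finset.sum_eq_zero fun m hm => ?_).symm
    rw [Finset.mem_Icc] at hm
    rw [e_eq_zero (by omega), smul_zero]

theorem bracket_toVec (hn : 1 ≤ n) (α : ℕ → ℂ) (θ : ℂ) (p : ℂ[X]) (v : Fin (n + 1) → ℂ) :
    bracket n α θ (toVec n p) v = toVec n ((C (v 0) * X + C (v 1) * symbol n α) * p) := by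
  induction p using Polynomial.induction_on' with
  | add p q hp hq => rw [mul_add, map_add, map_add, map_add, ← hp, ← hq, LinearMap.add_apply]
  | monomial k a =>
    rw [← C_mul_X_pow_eq_monomial, mul_left_comm, toVec_C_mul, toVec_C_mul, map_smul,
      LinearMap.smul_apply, toVec_X_pow, add_mul, map_add, mul_assoc, mul_assoc, toVec_C_mul,
      toVec_C_mul]
    congr 1
    by_cases hk : k + 1 ≤ n
    · rw [bracket_e hn _ _ hk, table_succ_zero, table_succ_one]
    · have h1 : X ^ n ∣ (X ^ k : ℂ[X]) := pow_dvd_pow _ (by omega)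
      rw [e_eq_zero (by omega), map_zero, LinearMap.zero_apply,
        (toVec_eq_zero_iff _).2 (h1.mul_left X), (toVec_eq_zero_iff _).2 (h1.mul_left _)]
      simp

/-- The rows of `e_0` and `e_1` in the table differ only in the `e_n`-coefficient of the product
with `e_1`. -/
theorem bracket_diffVec (hn : 3 ≤ n) (α : ℕ → ℂ) (θ : ℂ) (v : Fin (n + 1) → ℂ) :
    bracket n α θ (diffVec n) v = toVec n (C (v 1 * (θ - α n)) * X ^ (n - 1)) := by
  have h1 : Finset.Icc 3 n = insert n (Finset.Icc 3 (n - 1)) := by ext; simp; omega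
  rw [diffVec, map_sub, LinearMap.sub_apply, bracket_e (by omega) _ _ (by omega),
    bracket_e (by omega) _ _ (by omega), toVec_C_mul, toVec_X_pow,
    show n - 1 + 1 = n by omega]
  have h2 : table n α θ 1 0 = table n α θ 0 0 := by
    simp [table, show 1 ≤ n - 1 by omega]
  have h3 : table n α θ 0 1 = table n α θ 1 1 + (θ - α n) • e n n := by
    simp only [table, if_true, if_false, one_ne_zero, show 1 ≤ n - 2 by omega,
      show n + 1 - 1 = n by omega]
    rw [h1, Finset.sum_insert (by simp; omega)]
    simp only [show ∀ m, 1 + m - 1 = m by omega, sub_smul]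
    abel
  rw [h2, h3, smul_add, smul_smul]
  abel

/-! ### Divisibility by powers of `X` under substitution -/

theorem X_pow_dvd_of_dvd_mul {p q : ℂ[X]} (hq : q.coeff 0 ≠ 0) (h : X ^ n ∣ p * q) :
    X ^ n ∣ p := by
  have h1 : IsCoprime X q := irreducible_X.coprime_iff_not_dvd.2 fun hX => hq (X_dvd_iff.1 hX)
  exact h1.pow_left.dvd_of_dvd_mul_right h

theorem X_pow_dvd_comp {p s : ℂ[X]} (hs : X ∣ s) (h : X ^ n ∣ p) : X ^ n ∣ p.comp s := by
  obtain ⟨q, rfl⟩ := h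
  rw [mul_comp, X_pow_comp]
  exact (pow_dvd_pow_of_dvd hs n).mul_right _

theorem X_pow_dvd_of_dvd_comp {s : ℂ[X]} (hs : s.coeff 0 = 0) (hs1 : s.coeff 1 ≠ 0) {p : ℂ[X]}
    (h : X ^ n ∣ p.comp s) : X ^ n ∣ p := by
  induction n generalizing p with
  | zero => simp
  | succ m ih =>
    obtain ⟨t, rfl⟩ := X_dvd_iff.2 hs
    rw [show 1 = 0 + 1 from rfl, coeff_X_mul] at hs1
    have h0 : p.coeff 0 = 0 := by
      have := X_pow_dvd_iff.1 h 0 (by omega)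
      rwa [coeff_zero_eq_eval_zero, eval_comp, eval_mul, eval_X, zero_mul,
        ← coeff_zero_eq_eval_zero] at this
    obtain ⟨q, rfl⟩ := X_dvd_iff.2 h0
    rw [mul_comp, X_comp, pow_succ', mul_assoc, mul_comm t] at h
    rw [pow_succ']
    exact mul_dvd_mul_left _
      (ih (X_pow_dvd_of_dvd_mul hs1 ((mul_dvd_mul_iff_left X_ne_zero).1 h)))

theorem X_sq_dvd_comp_symbol (α : ℕ → ℂ) {s : ℂ[X]} (hs : X ∣ s) :
    X ^ 2 ∣ (symbol n α).comp s :=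
  X_pow_dvd_comp hs (X_sq_dvd_symbol n α)

/-- The polynomial `A X + B (α_3 X² + ⋯ + α_n X^(n-1))`, through which right multiplication by
`A e_0 + B e_1` acts. -/
noncomputable def rightSymbol (n : ℕ) (α : ℕ → ℂ) (A B : ℂ) : ℂ[X] :=
  C A * X + C B * symbol n α

theorem rightSymbol_eq_X_mul (α : ℕ → ℂ) (A B : ℂ) :
    rightSymbol n α A B = X * (C A + C B * symbolDivX n α) := by
  rw [rightSymbol, symbol_eq_X_mul]; ring

theorem coeff_zero_rightSymbol_div (α : ℕ → ℂ) (A B : ℂ) :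
    (C A + C B * symbolDivX n α).coeff 0 = A := by
  simp [coeff_symbolDivX]

theorem coeff_zero_rightSymbol (α : ℕ → ℂ) (A B : ℂ) : (rightSymbol n α A B).coeff 0 = 0 := by
  simp [rightSymbol_eq_X_mul]

theorem coeff_one_rightSymbol (α : ℕ → ℂ) (A B : ℂ) : (rightSymbol n α A B).coeff 1 = A := by
  simp [rightSymbol, coeff_symbol]

theorem X_pow_dvd_rightSymbol_pow (α : ℕ → ℂ) (A B : ℂ) (k : ℕ) :
    X ^ k ∣ rightSymbol n α A B ^ k :=
  pow_dvd_pow_of_dvd (X_dvd_iff.2 (coeff_zero_rightSymbol α A B)) k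

theorem rightSymbol_pow_sub (α : ℕ → ℂ) (A B : ℂ) (k : ℕ) :
    X ^ (k + 1) ∣ rightSymbol n α A B ^ k - C (A ^ k) * X ^ k := by
  have h : rightSymbol n α A B ^ k - C (A ^ k) * X ^ k =
      X ^ k * ((C A + C B * symbolDivX n α) ^ k - C A ^ k) := by
    rw [rightSymbol_eq_X_mul, mul_pow, C_pow]; ring
  rw [h, pow_succ]
  refine mul_dvd_mul_left _ ((?_ : X ∣ _).trans (sub_dvd_pow_sub_pow _ _ k))
  rw [add_sub_cancel_left]
  exact (X_dvd_symbolDivX n α).mul_left _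

/-! ### Isomorphisms and the congruence -/

theorem isomorphic_of_dvd (hn : 3 ≤ n) {α α' : ℕ → ℂ} {θ θ' A B : ℂ} (hA : A ≠ 0)
    (hAB : A + B ≠ 0)
    (hα : X ^ n ∣ (symbol n α).comp (rightSymbol n α' A B) - C (A + B) * symbol n α')
    (hθ : θ' - α' n = A ^ (n - 2) * (θ - α n)) : Isomorphic n α θ α' θ' := by
  set s := rightSymbol n α' A B with hs
  have hXs : X ∣ s := X_dvd_iff.2 (coeff_zero_rightSymbol α' A B)
  -- The image of `e_0 - e_1`. The product of `A(e_0 - e_1)` with the image of `v` has an unwanted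
  -- `v_0`-part in `e_n`; the `e_{n-1}`-term cancels it.
  set w : Fin (n + 1) → ℂ :=
    A • diffVec n + toVec n (C (-(B * (θ' - α' n))) * X ^ (n - 2)) with hw
  let g : (Fin (n + 1) → ℂ) →ₗ[ℂ] (Fin (n + 1) → ℂ) :=
    (LinearMap.proj 0).smulRight w +
      toVec n ∘ₗ LinearMap.mulLeft ℂ (C (A + B)) ∘ₗ (aeval s).toLinearMap ∘ₗ tail n
  have hg : ∀ u, g u = u 0 • w + toVec n (C (A + B) * (tail n u).comp s) := fun u => rfl
  have hgvec : ∀ p, g (toVec n p) = toVec n (C (A + B) * p.comp s) := by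
    intro p
    rw [hg, toVec_zero_coord, zero_smul, zero_add, toVec_eq_iff, ← mul_sub, ← sub_comp]
    exact (X_pow_dvd_comp hXs (tail_toVec p)).mul_left _
  have hgdiff : g (diffVec n) = w := by
    have h0 : X ^ n ∣ tail n (diffVec n) := by
      rw [← toVec_eq_zero_iff, toVec_tail, diffVec_zero_coord, one_smul, sub_self]
    rw [hg, diffVec_zero_coord, one_smul,
      (toVec_eq_zero_iff _).2 ((X_pow_dvd_comp hXs h0).mul_left _), add_zero]
  have hg0 : ∀ u, g u 0 = A * u 0 := by
    intro u
    rw [hg, hw]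
    simp [mul_comm]
  have hg1 : ∀ u, g u 1 = B * u 0 + (A + B) * u 1 := by
    intro u
    have h1 : (tail n u).coeff 0 = u 1 + u 0 := by
      rw [← toVec_one_coord (n := n) (by omega), toVec_tail, Pi.sub_apply,
        Pi.smul_apply, diffVec_one_coord (by omega), smul_eq_mul]
      ring
    have h2 : ((tail n u).comp s).coeff 0 = u 1 + u 0 := by
      rw [coeff_zero_eq_eval_zero, eval_comp, ← coeff_zero_eq_eval_zero s, hs,
        coeff_zero_rightSymbol, ← coeff_zero_eq_eval_zero, h1]
    rw [hg, Pi.add_apply, Pi.smul_apply, toVec_one_coord (by omega), coeff_C_mul, h2, hw,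
      Pi.add_apply, Pi.smul_apply, toVec_one_coord (by omega), coeff_C_mul, coeff_X_pow,
      if_neg (by omega), diffVec_one_coord (by omega)]
    simp only [smul_eq_mul]
    ring
  have hinj : Function.Injective g := by
    rw [← LinearMap.ker_eq_bot, LinearMap.ker_eq_bot']
    intro u hu
    have h0 : u 0 = 0 := by
      have := hg0 u
      rw [hu, Pi.zero_apply] at this
      exact (mul_eq_zero.1 this.symm).resolve_left hA
    rw [hg, h0, zero_smul, zero_add, toVec_eq_zero_iff,
      (isUnit_C.2 (isUnit_iff_ne_zero.2 hAB)).dvd_mul_left] at hu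
    have h1 := X_pow_dvd_of_dvd_comp (coeff_zero_rightSymbol α' A B)
      (by rwa [coeff_one_rightSymbol]) hu
    rw [eq_add_toVec_tail u, h0, (toVec_eq_zero_iff _).2 h1]
    simp
  refine ⟨LinearEquiv.ofInjectiveEndo g hinj, fun u v => ?_⟩
  simp only [LinearEquiv.coe_ofInjectiveEndo]
  have hdiff : g (bracket n α θ (diffVec n) v) = bracket n α' θ' (g (diffVec n)) (g v) := by
    rw [bracket_diffVec hn, hgvec, hgdiff, hw, map_add (bracket n α' θ'), map_smul,
      LinearMap.add_apply, LinearMap.smul_apply, bracket_diffVec hn, bracket_toVec (by omega), hg0, hg1, ← toVec_C_mul,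
      ← map_add, toVec_eq_iff, mul_comp, C_comp, X_pow_comp, hθ]
    obtain ⟨q, hq⟩ := rightSymbol_pow_sub (n := n) α' A B (n - 1)
    obtain ⟨r, hr⟩ := X_sq_dvd_symbol n α'
    rw [← hs, show n - 1 + 1 = n by omega, sub_eq_iff_eq_add] at hq
    rw [hq, hr]
    obtain ⟨m, rfl⟩ := Nat.exists_eq_add_of_le hn
    rw [show 3 + m - 1 = m + 2 by omega, show 3 + m - 2 = m + 1 by omega]
    simp only [C_mul, C_add, C_neg, C_pow]
    refine ⟨C (A + B) * C (v 1 * (θ - α (3 + m))) * q + C (B * v 0 + (A + B) * v 1) * r *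
      C (B * (A ^ (m + 1) * (θ - α (3 + m)))), ?_⟩
    simp only [C_mul, C_add, C_pow]
    ring
  have hvec : ∀ p, g (bracket n α θ (toVec n p) v) = bracket n α' θ' (g (toVec n p)) (g v) := by
    intro p
    rw [bracket_toVec (by omega), hgvec, hgvec, bracket_toVec (by omega), hg0, hg1, toVec_eq_iff]
    obtain ⟨q, hq⟩ := hα
    rw [sub_eq_iff_eq_add] at hq
    simp only [mul_comp, add_comp, C_comp, X_comp]
    rw [hq, hs, rightSymbol]
    refine ⟨C (A + B) * C (v 1) * q * p.comp s, ?_⟩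
    rw [hs, rightSymbol]
    simp only [C_mul, C_add]
    ring
  rw [eq_add_toVec_tail u]
  simp only [map_add, map_smul, LinearMap.add_apply, LinearMap.smul_apply, hdiff, hvec]

/-- The images of `e_0` and `e_1` determine `g`. Products with these two vectors force `g(e_1)` to
have no `e_0`-component and its `e_1`-component `D` to equal `A + B`. -/
theorem Isomorphic.exists_dvd (hn : 4 ≤ n) {α α' : ℕ → ℂ} {θ θ' : ℂ}
    (h : Isomorphic n α θ α' θ') : ∃ A B : ℂ, A ≠ 0 ∧ A + B ≠ 0 ∧
      X ^ n ∣ (symbol n α).comp (rightSymbol n α' A B) - C (A + B) * symbol n α' ∧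
      θ' - α' n = A ^ (n - 2) * (θ - α n) := by
  obtain ⟨g, hg⟩ := h
  have hn1 : 1 ≤ n := by omega
  have hn3 : 3 ≤ n := by omega
  have he00 : e n 0 0 = 1 := by simp [e]
  have he01 : e n 0 1 = 0 := by rw [e, val_one_of_pos hn1]; simp
  have he10 : e n 1 0 = 0 := by simp [e]
  have he11 : e n 1 1 = 1 := by rw [e, val_one_of_pos hn1]; simp
  set A := g (e n 0) 0 with hA
  set B := g (e n 0) 1 with hB
  set c := g (e n 1) 0 with hc
  set D := g (e n 1) 1 with hD
  set δ := θ - α n with hδ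
  set δ' := θ' - α' n with hδ'
  set s := rightSymbol n α' A B with hs
  have hXs : X ∣ s := X_dvd_iff.2 (coeff_zero_rightSymbol α' A B)
  set q := tail n (g (e n 1)) with hq
  have hge1 : g (e n 1) = c • diffVec n + toVec n q := eq_add_toVec_tail _
  have hq0 : q.coeff 0 = c + D := by
    rw [← toVec_one_coord hn1, hq, toVec_tail, Pi.sub_apply, Pi.smul_apply,
      diffVec_one_coord hn1, smul_eq_mul]
    ring
  have hmulX : ∀ p r, g (toVec n p) = toVec n r → g (toVec n (X * p)) = toVec n (s * r) := by
    intro p r hpr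
    have := hg (toVec n p) (e n 0)
    rw [bracket_toVec hn1, he00, he01, hpr, bracket_toVec hn1] at this
    simpa [hs, rightSymbol] using this
  have hcomp : ∀ p₀ r₀, g (toVec n p₀) = toVec n r₀ →
      ∀ p, g (toVec n (p * p₀)) = toVec n (p.comp s * r₀) := by
    intro p₀ r₀ h₀ p
    induction p using Polynomial.induction_on' with
    | add p q hp hq => rw [add_mul, map_add, map_add, hp, hq, add_comp, add_mul, map_add]
    | monomial k a =>
      rw [← C_mul_X_pow_eq_monomial, mul_assoc, toVec_C_mul, map_smul, mul_comp, C_comp,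
        mul_assoc, toVec_C_mul, X_pow_comp]
      congr 1
      induction k with
      | zero => simpa using h₀
      | succ k ih => rw [pow_succ', pow_succ', mul_assoc, mul_assoc]; exact hmulX _ _ ih
  set q₁ := s * q + C (c * B * δ') * X ^ (n - 1) with hq₁
  have hgX : g (toVec n X) = toVec n q₁ := by
    have := hg (toVec n 1) (e n 0)
    rw [bracket_toVec hn1, he00, he01, ← pow_zero X, toVec_X_pow, zero_add, hge1, map_add,
      map_smul, LinearMap.add_apply, LinearMap.smul_apply, bracket_diffVec hn3,
      bracket_toVec hn1, ← toVec_C_mul, ← map_add] at this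
    rw [hq₁, hs, rightSymbol]
    convert this using 2
    · simp
    · simp only [C_mul, ← hA, ← hB, ← hδ']; ring
  have hq₁0 : q₁.coeff 0 = 0 := by
    rw [hq₁, coeff_add, mul_coeff_zero, hs, coeff_zero_rightSymbol, coeff_C_mul, coeff_X_pow,
      if_neg (by omega)]
    simp
  obtain ⟨q₂, hq₂⟩ := X_dvd_iff.2 hq₁0
  have hq₂0 : q₂.coeff 0 = A * (c + D) := by
    rw [← coeff_X_mul, ← hq₂, hq₁, coeff_add, hs, rightSymbol_eq_X_mul, mul_assoc, coeff_X_mul,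
      mul_coeff_zero, coeff_zero_rightSymbol_div, hq0, coeff_C_mul, coeff_X_pow,
      if_neg (by omega)]
    ring
  -- Otherwise `X²` divides the image of `X`, and `X^(n-1)`, which represents `e_n`, is sent to
  -- zero.
  have hAcD : A ≠ 0 ∧ c + D ≠ 0 := by
    rw [← mul_ne_zero_iff, ← hq₂0]
    intro h0
    have h1 := hcomp X q₁ hgX (X ^ (n - 2))
    rw [X_pow_comp] at h1
    obtain ⟨q₃, hq₃⟩ := X_dvd_iff.2 h0
    have h2 : X ^ n ∣ s ^ (n - 2) * q₁ := by
      rw [hq₂, hq₃, ← mul_assoc X, ← mul_assoc, show n = (n - 2) + 2 by omega, pow_add]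
      refine (mul_dvd_mul (X_pow_dvd_rightSymbol_pow _ _ _ _) (by rw [pow_two])).mul_right _
    rw [(toVec_eq_zero_iff _).2 h2, LinearEquiv.map_eq_zero_iff, toVec_eq_zero_iff,
      ← pow_succ] at h1
    have h3 := X_pow_dvd_iff.1 h1 (n - 1) (by omega)
    rw [coeff_X_pow, if_pos (by omega)] at h3
    exact one_ne_zero h3
  obtain ⟨hA0, hcD⟩ := hAcD
  -- The product of `e_2` and `e_1` is used, since `g(e_1)` may still involve `e_0 - e_1`. Its image
  -- is `X` times a unit times `f(s) - cX - D f'`, and degree 2 isolates `c`.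
  have hc0 : c = 0 := by
    have h1 := hg (toVec n X) (e n 1)
    rw [bracket_toVec hn1, he10, he11, hgX, bracket_toVec hn1, ← hc, ← hD] at h1
    have h2 : (C 0 * X + C 1 * symbol n α) * X = symbol n α * X := by simp
    rw [h2, hcomp X q₁ hgX, toVec_eq_iff, ← sub_mul, hq₂, mul_comm X, ← mul_assoc] at h1
    have h3 := X_pow_dvd_of_dvd_mul (by rw [hq₂0]; exact mul_ne_zero hA0 hcD)
      (by rwa [mul_right_comm] at h1)
    have h4 := X_pow_dvd_iff.1 h3 2 (by omega)
    rw [coeff_mul_X, coeff_sub, coeff_add, coeff_C_mul, coeff_C_mul, coeff_X_one, coeff_symbol,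
      if_neg (by omega), X_pow_dvd_iff.1 (X_sq_dvd_comp_symbol α hXs) 1 (by omega)] at h4
    simpa using h4
  have hge1' : g (e n 1) = toVec n q := by rw [hge1, hc0, zero_smul, zero_add]
  have hq0D : q.coeff 0 = D := by rw [hq0, hc0, zero_add]
  have hD0 : D ≠ 0 := by rwa [hc0, zero_add] at hcD
  have hg1 : g (toVec n 1) = toVec n q := by
    rw [← hge1', ← pow_zero X, toVec_X_pow]
  have hF : X ^ n ∣ (symbol n α).comp s - C D * symbol n α' := by
    have h1 := hg (toVec n 1) (e n 1)
    rw [bracket_toVec hn1, he10, he11, hg1, bracket_toVec hn1, ← hc, ← hD, hc0] at h1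
    have h2 : (C 0 * X + C 1 * symbol n α) * 1 = symbol n α * 1 := by simp
    rw [h2, hcomp 1 q hg1, toVec_eq_iff, ← sub_mul, C_0, zero_mul, zero_add] at h1
    exact X_pow_dvd_of_dvd_mul (by rwa [hq0D]) h1
  set w := tail n (g (diffVec n)) with hw
  have hd0 : g (diffVec n) 0 = A := by
    rw [diffVec, map_sub, Pi.sub_apply, ← hA, ← hc, hc0, sub_zero]
  have hd1 : g (diffVec n) 1 = B - D := by
    rw [diffVec, map_sub, Pi.sub_apply]
  have hgd : g (diffVec n) = A • diffVec n + toVec n w := by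
    rw [← hd0]; exact eq_add_toVec_tail _
  have hw0 : w.coeff 0 = A + B - D := by
    rw [← toVec_one_coord hn1, hw, toVec_tail, Pi.sub_apply, Pi.smul_apply,
      diffVec_one_coord hn1, hd0, hd1, smul_eq_mul]
    ring
  -- This is the image of `[e_0 - e_1, e_0] = 0`. It forces `X^(n-2)` to divide `w`, whose constant
  -- term `A + B - D` must then vanish.
  have hw' : X ^ n ∣ s * w + C (A * B * δ') * X ^ (n - 1) := by
    have h1 := hg (diffVec n) (e n 0)
    rw [bracket_diffVec hn3, he01, zero_mul, C_0, zero_mul, map_zero, map_zero, hgd,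
      map_add (bracket n α' θ'), map_smul, LinearMap.add_apply, LinearMap.smul_apply,
      bracket_diffVec hn3, bracket_toVec hn1, ← toVec_C_mul, ← map_add, eq_comm,
      toVec_eq_zero_iff] at h1
    convert h1 using 1
    simp only [hs, rightSymbol, C_mul, ← hA, ← hB, ← hδ']
    ring
  have hsw : X ^ (n - 1) ∣ s * w := by
    have h1 : X ^ (n - 1) ∣ C (A * B * δ') * X ^ (n - 1) := dvd_mul_left _ _
    exact (dvd_add_left h1).1 ((pow_dvd_pow X (by omega)).trans hw')
  have hwX : X ^ (n - 2) ∣ w := by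
    rw [hs, rightSymbol_eq_X_mul, show n - 1 = (n - 2) + 1 by omega, pow_succ', mul_assoc,
      mul_dvd_mul_iff_left X_ne_zero, mul_comm] at hsw
    exact X_pow_dvd_of_dvd_mul (by rwa [coeff_zero_rightSymbol_div]) hsw
  have hABD : D = A + B := by
    have := X_pow_dvd_iff.1 hwX 0 (by omega)
    rw [hw0] at this
    linear_combination -this
  refine ⟨A, B, hA0, hABD ▸ hD0, hABD ▸ hF, ?_⟩
  -- The top coefficient of this identity relates `δ` and `δ'`.
  have h1 := hg (diffVec n) (e n 1)
  have h2 : X ^ n ∣ (C 0 * X + C D * symbol n α') * w := by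
    rw [C_0, zero_mul, zero_add, mul_assoc, show n = 2 + (n - 2) by omega, pow_add]
    exact (mul_dvd_mul (show X ^ 2 ∣ symbol (2 + (n - 2)) α' from X_sq_dvd_symbol _ _)
      (by simpa using hwX)).mul_left _
  rw [bracket_diffVec hn3, he11, one_mul, hgd, map_add (bracket n α' θ'), map_smul,
    LinearMap.add_apply, LinearMap.smul_apply, bracket_diffVec hn3, bracket_toVec hn1, ← hc,
    ← hD, hc0, (toVec_eq_zero_iff _).2 h2, add_zero, ← mul_one (C _ * X ^ _),
    hcomp 1 q hg1, ← toVec_C_mul, toVec_eq_iff, ← hδ, ← hδ', mul_comp, C_comp, X_pow_comp] at h1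
  have h3 := X_pow_dvd_iff.1 h1 (n - 1) (by omega)
  have h4 : (s ^ (n - 1) * q).coeff (n - 1) = A ^ (n - 1) * D := by
    rw [hs, rightSymbol_eq_X_mul, mul_pow, mul_assoc]
    nth_rw 3 [show n - 1 = 0 + (n - 1) by omega]
    rw [coeff_X_pow_mul, mul_coeff_zero, hq0D, coeff_zero_eq_eval_zero, eval_pow,
      ← coeff_zero_eq_eval_zero, coeff_zero_rightSymbol_div]
  rw [coeff_sub, mul_assoc, coeff_C_mul, h4, coeff_C_mul, coeff_C_mul, coeff_X_pow,
    if_pos rfl, mul_one, show n - 1 = (n - 2) + 1 by omega, pow_succ] at h3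
  have h5 : A * D ≠ 0 := mul_ne_zero hA0 hD0
  apply mul_left_cancel₀ h5
  linear_combination -h3

/-! ### Semi-invariants in low degree -/

theorem phi_three (z : ℕ → ℂ) (y : ℂ) : phi z y 3 = (1 + y) * z 3 := by
  rw [phi_eq]; simp

theorem phi_four (z : ℕ → ℂ) (y : ℂ) :
    phi z y 4 = (1 + y) * z 4 - 2 * y * z 3 * phi z y 3 := by
  rw [phi_eq]
  simp [Finset.sum_Icc_succ_top, coef, nest]

theorem phi_five (z : ℕ → ℂ) (y : ℂ) :
    phi z y 5 = (1 + y) * z 5 - (2 * y * z 4 + y ^ 2 * z 3 ^ 2) * phi z y 3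
      - 3 * y * z 3 * phi z y 4 := by
  rw [phi_eq]
  simp [Finset.sum_Icc_succ_top, coef, nest]
  ring

theorem phi_six (z : ℕ → ℂ) (y : ℂ) :
    phi z y 6 = (1 + y) * z 6 - (2 * y * z 5 + 2 * y ^ 2 * z 3 * z 4) * phi z y 3
      - (3 * y * z 4 + 3 * y ^ 2 * z 3 ^ 2) * phi z y 4 - 4 * y * z 3 * phi z y 5 := by
  rw [phi_eq]
  simp [Finset.sum_Icc_succ_top, coef, nest, Nat.choose]
  ring

/-- Conceptually, `f(X + y f_z) = (1 + y) f_z` says that passing from `f_z` to `f` multiplies the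
nonlinear part of the compositional inverse of `X - f_z` by `1 + y`. The coefficients of that
inverse in degrees 3, 4, 5 reduce, once the first vanishes, to the expressions here and in the next
two lemmas, which are checked by expansion. -/
theorem phi_four_add {z : ℕ → ℂ} (y : ℂ) (h : z 4 + 2 * z 3 ^ 2 = 0) :
    phi z y 4 + 2 * phi z y 3 ^ 2 = 0 := by
  rw [phi_four, phi_three]; linear_combination (1 + y) * h

theorem phi_five_sub {z : ℕ → ℂ} (y : ℂ) (h : z 4 + 2 * z 3 ^ 2 = 0) :
    phi z y 5 - 5 * phi z y 3 ^ 3 = (1 + y) * (z 5 - 5 * z 3 ^ 3) := by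
  have h4 : z 4 = -2 * z 3 ^ 2 := by linear_combination h
  rw [phi_five, phi_four, phi_three, h4]; ring

theorem phi_six_add {z : ℕ → ℂ} (y : ℂ) (h : z 4 + 2 * z 3 ^ 2 = 0) :
    phi z y 6 + 6 * phi z y 3 * phi z y 5 - 16 * phi z y 3 ^ 4 =
      (1 + y) * (z 6 + 6 * z 3 * z 5 - 16 * z 3 ^ 4) := by
  have h4 : z 4 = -2 * z 3 ^ 2 := by linear_combination h
  rw [phi_six, phi_five, phi_four, phi_three, h4]; ring

theorem phi_zero_right (z : ℕ → ℂ) (t : ℕ) : phi z 0 t = z t := by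
  have h : ∀ k, coef z 0 k t = 0 := fun k => Finset.sum_eq_zero fun j hj => by
    have := (Finset.mem_Icc.1 hj).1
    rw [zero_pow (by omega), mul_zero, zero_mul]
  rw [phi_eq]
  simp [h]

/-! ### Isomorphism classes as orbits of the transformations -/

theorem Isomorphic.symm {n : ℕ} {α α' : ℕ → ℂ} {θ θ' : ℂ} (h : Isomorphic n α θ α' θ') :
    Isomorphic n α' θ' α θ := by
  obtain ⟨g, hg⟩ := h
  exact ⟨g.symm, fun u v => by rw [LinearEquiv.symm_apply_eq, hg]; simp⟩

theorem Isomorphic.trans {n : ℕ} {α α' α'' : ℕ → ℂ} {θ θ' θ'' : ℂ}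
    (h : Isomorphic n α θ α' θ') (h' : Isomorphic n α' θ' α'' θ'') :
    Isomorphic n α θ α'' θ'' := by
  obtain ⟨g, hg⟩ := h
  obtain ⟨g', hg'⟩ := h'
  exact ⟨g.trans g', fun u v => by simp [hg, hg']⟩

/-- `L(β, η)` and `L(z, θ)` are isomorphic if and only if the parameters of the former are
obtained from those of the latter by a transformation with `x ≠ 0` and `y ≠ -1`. -/
theorem isomorphic_iff_isTransform {n : ℕ} (hn : 4 ≤ n) {β z : ℕ → ℂ} {η θ : ℂ} :
    Isomorphic n β η z θ ↔ ∃ x y : ℂ, x ≠ 0 ∧ 1 + y ≠ 0 ∧ IsTransform n x y z θ β η := by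
  constructor
  · intro h
    obtain ⟨A, B, hA, hAB, h1, h2⟩ := h.exists_dvd hn
    refine ⟨A⁻¹, B / A, inv_ne_zero hA, ?_, (isTransform_iff (by omega) hA B z θ β η).2 ⟨h1, h2⟩⟩
    rw [show 1 + B / A = (A + B) / A by field_simp]
    exact div_ne_zero hAB hA
  · rintro ⟨x, y, hx, hy, h⟩
    have hA : x⁻¹ ≠ 0 := inv_ne_zero hx
    have h' : IsTransform n (x⁻¹)⁻¹ (y * x⁻¹ / x⁻¹) z θ β η := by
      rwa [inv_inv, mul_div_cancel_right₀ _ hA]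
    obtain ⟨h1, h2⟩ := (isTransform_iff (by omega) hA (y * x⁻¹) z θ β η).1 h'
    refine isomorphic_of_dvd (by omega) hA ?_ h1 h2
    rw [show x⁻¹ + y * x⁻¹ = (1 + y) * x⁻¹ by ring]
    exact mul_ne_zero hy hA

/-! ### Normal forms -/

/-- The parameter `x` that normalizes an algebra in the stratum. -/
noncomputable def normX (α : ℕ → ℂ) : ℂ :=
  (5 * α 3 ^ 3 - α 5) / (α 6 + 6 * α 3 * α 5 - 16 * α 3 ^ 4)

/-- The parameter `y` that normalizes an algebra in the stratum. -/
noncomputable def normY (α : ℕ → ℂ) : ℂ :=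
  (α 6 + 7 * α 3 * α 5 - 21 * α 3 ^ 4) / (α 3 * (5 * α 3 ^ 3 - α 5))

/-- The coefficients `α_3, …, α_n` of the normalized algebra. -/
noncomputable def normCoeff (α : ℕ → ℂ) (t : ℕ) : ℂ :=
  normX α ^ (t - 2) * phi α (normY α) t

/-- The coefficient `θ` of the normalized algebra. -/
noncomputable def normTheta (n : ℕ) (α : ℕ → ℂ) (θ : ℂ) : ℂ :=
  normX α ^ (n - 2) * phiLast n α θ (normY α)

theorem rhoNorm_of_ne {n i : ℕ} (hi : i ≠ n - 1) (α : ℕ → ℂ) (θ : ℂ) :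
    rhoNorm n i α θ = normCoeff α (i + 2) := by
  rw [rhoNorm, rho, if_neg hi]; rfl

theorem rhoNorm_last (n : ℕ) (α : ℕ → ℂ) (θ : ℂ) :
    rhoNorm n (n - 1) α θ = normTheta n α θ := by
  rw [rhoNorm, rho, if_pos rfl]; rfl

/-- The normal forms of the algebras in the stratum. -/
structure IsNormal (β : ℕ → ℂ) : Prop where
  three : β 3 = 1
  four : β 4 = -2
  six : β 6 = 21 - 7 * β 5
  five : β 5 ≠ 5

theorem IsNormal.inStratum {β : ℕ → ℂ} (h : IsNormal β) : InStratum β := by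
  have h5 : β 5 - 5 ≠ 0 := sub_ne_zero.2 h.five
  refine ⟨by rw [h.three]; exact one_ne_zero, by rw [h.three, h.four]; ring, ?_⟩
  rw [h.six, h.three]
  refine mul_ne_zero (by simpa using h5) ?_
  rw [show 21 - 7 * β 5 + 6 * 1 * β 5 - 16 * 1 ^ 4 = -(β 5 - 5) by ring]
  exact neg_ne_zero.2 h5

theorem IsNormal.normX_eq {β : ℕ → ℂ} (h : IsNormal β) : normX β = 1 := by
  have h5 : 5 - β 5 ≠ 0 := sub_ne_zero.2 h.five.symm
  rw [normX, h.six, h.three, div_eq_one_iff_eq]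
  · ring
  · rw [show 21 - 7 * β 5 + 6 * 1 * β 5 - 16 * 1 ^ 4 = 5 - β 5 by ring]
    exact h5

theorem IsNormal.normY_eq {β : ℕ → ℂ} (h : IsNormal β) : normY β = 0 := by
  rw [normY, h.six, h.three]
  rw [show 21 - 7 * β 5 + 7 * 1 * β 5 - 21 * 1 ^ 4 = 0 by ring, zero_div]

theorem IsNormal.eq_of_isTransform {n : ℕ} (hn : 6 ≤ n) {β z : ℕ → ℂ} {x y η θ : ℂ}
    (hβ : IsNormal β) (hz : IsNormal z) (hx : x ≠ 0)
    (h : IsTransform n x y z θ β η) : x = 1 ∧ y = 0 := by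
  have h4 : z 4 + 2 * z 3 ^ 2 = 0 := hz.inStratum.2.1
  have e3 := h.1 3 le_rfl (by omega)
  have e5 := h.1 5 (by omega) (by omega)
  have e6 := h.1 6 (by omega) (by omega)
  have p5 := phi_five_sub y h4
  have p6 := phi_six_add y h4
  have p3 := phi_three z y
  have e6' := hβ.six
  rw [hβ.three] at e3
  rw [hz.three] at p3 p5 p6
  rw [hz.six] at p6
  rw [p3] at e3 p5 p6
  norm_num at e3 e5 e6
  have hxy : x * (1 + y) = 1 := e3.symm
  have k5 : β 5 - 5 = x ^ 2 * (z 5 - 5) := by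
    linear_combination e5 + x ^ 3 * p5 + (5 * (x ^ 2 * (1 + y) ^ 2 + x * (1 + y) + 1)
      + x ^ 2 * (z 5 - 5)) * hxy
  have k6 : β 6 + 6 * β 5 - 16 = x ^ 3 * (5 - z 5) := by
    linear_combination e6 + 6 * e5 + x ^ 4 * p6 - 6 * x ^ 3 * phi z y 5 * hxy
      + (16 * (x ^ 3 * (1 + y) ^ 3 + x ^ 2 * (1 + y) ^ 2 + x * (1 + y) + 1)
        + x ^ 3 * (5 - z 5)) * hxy
  -- Both forms satisfy `D_6 = -D_5`, while `D_5` scales by `x²` and `D_6` by `x³` once `x(1+y) =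
  -- 1`.
  have k : (x - 1) * (x ^ 2 * (z 5 - 5)) = 0 := by
    linear_combination k6 - e6' + k5
  have hx1 : x = 1 := by
    refine sub_eq_zero.1 ((mul_eq_zero.1 k).resolve_right ?_)
    exact mul_ne_zero (pow_ne_zero _ hx) (sub_ne_zero.2 hz.five)
  refine ⟨hx1, ?_⟩
  rw [hx1] at hxy
  linear_combination hxy

theorem InStratum.normX_ne_zero {α : ℕ → ℂ} (h : InStratum α) : normX α ≠ 0 := by
  obtain ⟨-, -, h⟩ := h
  obtain ⟨h5, h6⟩ := mul_ne_zero_iff.1 h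
  exact div_ne_zero (by rwa [← neg_sub, neg_ne_zero]) h6

theorem InStratum.one_add_normY {α : ℕ → ℂ} (h : InStratum α) :
    1 + normY α =
      (α 6 + 6 * α 3 * α 5 - 16 * α 3 ^ 4) / (α 3 * (5 * α 3 ^ 3 - α 5)) := by
  have h5 : 5 * α 3 ^ 3 - α 5 ≠ 0 := by
    rw [← neg_sub, neg_ne_zero]; exact (mul_ne_zero_iff.1 h.2.2).1
  have h3 := h.1
  rw [normY, eq_div_iff (mul_ne_zero h3 h5), add_mul, div_mul_cancel₀ _ (mul_ne_zero h3 h5)]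
  ring

theorem InStratum.one_add_normY_ne_zero {α : ℕ → ℂ} (h : InStratum α) : 1 + normY α ≠ 0 := by
  rw [h.one_add_normY]
  obtain ⟨h5, h6⟩ := mul_ne_zero_iff.1 h.2.2
  exact div_ne_zero h6 (mul_ne_zero h.1 (by rwa [← neg_sub, neg_ne_zero]))

/-- `normX` and `normY` solve `x D_6 = -D_5` and `x(1+y)α_3 = 1`, which are the two normalizing
conditions. -/
theorem InStratum.isNormal_normCoeff {α : ℕ → ℂ} (h : InStratum α) : IsNormal (normCoeff α) := by
  obtain ⟨h5, h6⟩ := mul_ne_zero_iff.1 h.2.2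
  have h5' : 5 * α 3 ^ 3 - α 5 ≠ 0 := by rwa [← neg_sub, neg_ne_zero]
  have h3 := h.1
  have hx : normX α * (α 6 + 6 * α 3 * α 5 - 16 * α 3 ^ 4) = 5 * α 3 ^ 3 - α 5 :=
    div_mul_cancel₀ _ h6
  have hxy : normX α * ((1 + normY α) * α 3) = 1 := by
    rw [h.one_add_normY, ← mul_left_inj' h5', one_mul, ← hx]
    field_simp
  have p3 := phi_three α (normY α)
  have p4 := phi_four_add (normY α) h.2.1
  have p5 := phi_five_sub (normY α) h.2.1
  have p6 := phi_six_add (normY α) h.2.1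
  rw [← p3] at hxy
  have k5 : normCoeff α 5 - 5 = normX α ^ 3 * ((1 + normY α) * (α 5 - 5 * α 3 ^ 3)) := by
    rw [normCoeff]
    generalize phi α (normY α) 3 = f at *
    norm_num
    linear_combination normX α ^ 3 * p5 + 5 * ((normX α * f) ^ 2 + normX α * f + 1) * hxy
  refine ⟨by rw [normCoeff]; simpa using hxy, ?_, ?_, ?_⟩
  · rw [normCoeff]
    generalize phi α (normY α) 3 = f at *
    norm_num
    linear_combination normX α ^ 2 * p4 - 2 * (normX α * f + 1) * hxy
  · have k6 : normCoeff α 6 + 6 * normCoeff α 5 - 16 =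
        normX α ^ 4 * ((1 + normY α) * (α 6 + 6 * α 3 * α 5 - 16 * α 3 ^ 4)) := by
      rw [normCoeff, normCoeff]
      generalize phi α (normY α) 3 = f at *
      norm_num
      linear_combination normX α ^ 4 * p6 - 6 * normX α ^ 3 * phi α (normY α) 5 * hxy
        + 16 * ((normX α * f) ^ 3 + (normX α * f) ^ 2 + normX α * f + 1) * hxy
    linear_combination k6 + k5 + normX α ^ 3 * (1 + normY α) * hx
  · rw [← sub_ne_zero, k5]
    exact mul_ne_zero (pow_ne_zero _ h.normX_ne_zero) (mul_ne_zero h.one_add_normY_ne_zero h5)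

theorem isTransform_norm (n : ℕ) (α : ℕ → ℂ) (θ : ℂ) :
    IsTransform n (normX α) (normY α) α θ (normCoeff α) (normTheta n α θ) :=
  ⟨fun _ _ _ => rfl, rfl⟩

theorem InStratum.isomorphic_norm {α : ℕ → ℂ} (h : InStratum α) {n : ℕ} (hn : 4 ≤ n) (θ : ℂ) :
    Isomorphic n (normCoeff α) (normTheta n α θ) α θ :=
  (isomorphic_iff_isTransform hn).2
    ⟨_, _, h.normX_ne_zero, h.one_add_normY_ne_zero, isTransform_norm n α θ⟩

theorem isTransform_one_zero_iff {n : ℕ} (z : ℕ → ℂ) (θ : ℂ) (β : ℕ → ℂ) (η : ℂ) :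
    IsTransform n 1 0 z θ β η ↔ (∀ t, 3 ≤ t → t ≤ n → β t = z t) ∧ η = θ := by
  simp only [IsTransform, one_pow, one_mul, phi_zero_right, phiLast_eq, add_sub_cancel]

end Filiform

/-! ### Classification by normal forms -/

theorem theorem4 (n : ℕ) (hn : 6 ≤ n) :
    (∀ (α α' : ℕ → ℂ) (θ θ' : ℂ), Filiform.InStratum α → Filiform.InStratum α' →
      (Filiform.Isomorphic n α θ α' θ' ↔
        ∀ i, 4 ≤ i → i ≤ n - 1 → Filiform.rhoNorm n i α θ = Filiform.rhoNorm n i α' θ')) ∧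
    (∀ (α : ℕ → ℂ) (θ : ℂ), Filiform.InStratum α → Filiform.rhoNorm n 4 α θ ≠ -14) ∧
    (∀ a : ℕ → ℂ, a 4 ≠ -14 →
      ∃ (α : ℕ → ℂ) (θ : ℂ), Filiform.InStratum α ∧
        ∀ i, 4 ≤ i → i ≤ n - 1 → Filiform.rhoNorm n i α θ = a i) := by
  open Filiform in
  refine ⟨fun α α' θ θ' h h' => ?_, fun α θ h => ?_, fun a ha => ?_⟩
  · have hN := h.isNormal_normCoeff
    have hN' := h'.isNormal_normCoeff
    have key : Isomorphic n α θ α' θ' ↔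
        (∀ t, 3 ≤ t → t ≤ n → normCoeff α t = normCoeff α' t) ∧
          normTheta n α θ = normTheta n α' θ' := by
      have hiso := h.isomorphic_norm (n := n) (by omega) θ
      have hiso' := h'.isomorphic_norm (n := n) (by omega) θ'
      rw [← isTransform_one_zero_iff]
      constructor
      · intro hα
        obtain ⟨x, y, hx, hy, ht⟩ :=
          (isomorphic_iff_isTransform (by omega)).1 ((hiso.trans hα).trans hiso'.symm)
        obtain ⟨rfl, rfl⟩ := hN.eq_of_isTransform hn hN' hx ht
        exact ht
      · intro ht
        exact (hiso.symm.trans ((isomorphic_iff_isTransform (by omega)).2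
          ⟨1, 0, one_ne_zero, by simp, ht⟩)).trans hiso'
    rw [key]
    constructor
    · rintro ⟨hc, hθ⟩ i hi hin
      by_cases hi' : i = n - 1
      · rw [hi', rhoNorm_last, rhoNorm_last, hθ]
      · rw [rhoNorm_of_ne hi', rhoNorm_of_ne hi', hc _ (by omega) (by omega)]
    · intro hr
      have hc : ∀ t, 6 ≤ t → t ≤ n → normCoeff α t = normCoeff α' t := by
        intro t ht htn
        have := hr (t - 2) (by omega) (by omega)
        rwa [rhoNorm_of_ne (by omega), rhoNorm_of_ne (by omega),
          show t - 2 + 2 = t by omega] at this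
      refine ⟨fun t ht htn => ?_, ?_⟩
      · rcases (by omega : t = 3 ∨ t = 4 ∨ t = 5 ∨ 6 ≤ t) with rfl | rfl | rfl | h6
        · rw [hN.three, hN'.three]
        · rw [hN.four, hN'.four]
        -- No `R_i` records the fifth coefficient; it is recovered from the sixth, which is `R_4`.
        · have h6 := hc 6 le_rfl hn
          rw [hN.six, hN'.six] at h6
          linear_combination (-1 / 7) * h6
        · exact hc t h6 htn
      · have := hr (n - 1) (by omega) le_rfl
        rwa [rhoNorm_last, rhoNorm_last] at this
  · have hN := h.isNormal_normCoeff
    rw [rhoNorm_of_ne (by omega), hN.six]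
    intro h6
    exact hN.five (by linear_combination (-1 / 7) * h6)
  -- The fifth coefficient solves `a_4 = 21 - 7β_5`, so `a_4 ≠ -14` becomes `β_5 ≠ 5`. Being normal,
  -- `β` has `x = 1` and `y = 0`, so its `R_i` are read off directly.
  · let β : ℕ → ℂ := fun t =>
      if t = 3 then 1 else if t = 4 then -2 else if t = 5 then (21 - a 4) / 7 else a (t - 2)
    have hβ : IsNormal β := by
      refine ⟨by simp [β], by simp [β], ?_, ?_⟩
      · simp only [β]; norm_num; ring
      · intro h5
        simp only [β] at h5
        norm_num at h5
        exact ha (by linear_combination (-7) * h5)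
    refine ⟨β, a (n - 1), hβ.inStratum, fun i hi hin => ?_⟩
    by_cases hi' : i = n - 1
    · rw [hi', rhoNorm_last, normTheta, hβ.normX_eq, hβ.normY_eq, phiLast_eq, phi_zero_right]
      simp
    · rw [rhoNorm_of_ne hi', normCoeff, hβ.normX_eq, hβ.normY_eq, phi_zero_right]
      simp [β, show i + 2 ≠ 3 by omega, show i + 2 ≠ 4 by omega, show i + 2 ≠ 5 by omega]
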